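/- Let $K$ be a field of characteristic $0$. Let $Mag$ be the nonsymmetric (ns) operad over $K$ of magmatic algebras, i.e. the free ns operad on one binary operation $\square$. Let $Dend$ be the ns operad over $K$ of dendriform algebras, i.e. the quotient of the free ns operad on two binary operations $\prec,\succ$ by the operadic ideal generated by the three relations $$(x\prec y)\prec z = x\prec(y\prec z)+x\prec(y\succ z),\qquad (x\succ y)\prec z = x\succ(y\prec z),\qquad (x\prec y)\succ z+(x\succ y)\succ z = x\succ(y\succ z).$$ Then there is exactly one morphism of ns operads $\varphi\colon Mag\to Dend$ that sends the generating operation to $x\,\square\, y := x\prec y - x\succ y$, and it is injective: for every $n$ the linear map $\varphi_n\colon Mag_n\to Dend_n$ is injective. -/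

import Mathlib

universe u v w

/-! ### Nonsymmetric operads over a commutative ring, in the partial-composition presentation -/

/-- A nonsymmetric (ns) operad in `K`-modules. `obj n` is the module of operations of arity `n`.
The partial composite `comp a b hm hr f g` plugs `g` (arity `n`) into the input of
`f` (arity `m = a + 1 + b`) which has `a` inputs on its left and `b` inputs on its right, i.e. it is
`f ∘_{a+1} g`; the result has arity `r = a + n + b`. -/
structure NSOperad (K : Type u) [CommRing K] where
  /-- operations of arity `n` -/
  obj : ℕ → Type v
  [addCommGroup : ∀ n, AddCommGroup (obj n)]
  [module : ∀ n, Module K (obj n)]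
  /-- the identity operation -/
  one : obj 1
  /-- partial composition -/
  comp : ∀ (a b : ℕ) {m n r : ℕ}, m = a + 1 + b → r = a + n + b →
    (obj m →ₗ[K] obj n →ₗ[K] obj r)
  /-- plugging `f` into the identity gives `f` -/
  one_comp : ∀ {n : ℕ} (h1 : 1 = 0 + 1 + 0) (hn : n = 0 + n + 0) (f : obj n),
    comp 0 0 h1 hn one f = f
  /-- plugging the identity into `f` gives `f` -/
  comp_one : ∀ (a b : ℕ) {m : ℕ} (hm hm' : m = a + 1 + b) (f : obj m),
    comp a b hm hm' f one = f
  /-- sequential composition axiom -/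
  comp_seq : ∀ (a b c d : ℕ) {l m n q r s : ℕ}
    (hl : l = a + 1 + b) (hm : m = c + 1 + d)
    (hq : q = a + m + b) (hr : r = c + n + d)
    (hq' : q = (a + c) + 1 + (d + b)) (hs : s = (a + c) + n + (d + b)) (hs' : s = a + r + b)
    (f : obj l) (g : obj m) (h : obj n),
    comp (a + c) (d + b) hq' hs (comp a b hl hq f g) h
      = comp a b hl hs' f (comp c d hm hr g h)
  /-- parallel composition axiom -/
  comp_par : ∀ (a b c : ℕ) {l m n q r s : ℕ}
    (hl : l = a + 1 + (b + 1 + c)) (hl' : l = (a + 1 + b) + 1 + c)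
    (hq : q = a + m + (b + 1 + c)) (hq' : q = (a + m + b) + 1 + c)
    (hr : r = (a + 1 + b) + n + c) (hr' : r = a + 1 + (b + n + c))
    (hs : s = (a + m + b) + n + c) (hs' : s = a + m + (b + n + c))
    (f : obj l) (g : obj m) (h : obj n),
    comp (a + m + b) c hq' hs (comp a (b + 1 + c) hl hq f g) h
      = comp a (b + n + c) hr' hs' (comp (a + 1 + b) c hl' hr f h) g

namespace NSOperad

attribute [instance] NSOperad.addCommGroup NSOperad.module

/-- Morphisms of ns operads: linear maps in each arity, compatible with the identity operation and
with all partial compositions. -/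
@[ext]
structure Hom {K : Type u} [CommRing K] (P : NSOperad.{u, v} K) (Q : NSOperad.{u, w} K) where
  /-- the component in arity `n` -/
  app : ∀ n, P.obj n →ₗ[K] Q.obj n
  map_one : app 1 P.one = Q.one
  map_comp : ∀ (a b : ℕ) {m n r : ℕ} (hm : m = a + 1 + b) (hr : r = a + n + b)
    (f : P.obj m) (g : P.obj n),
    app r (P.comp a b hm hr f g) = Q.comp a b hm hr (app m f) (app n g)

/-- A morphism of ns operads is injective if it is injective in every arity. -/
def Hom.Injective {K : Type u} [CommRing K] {P : NSOperad.{u, v} K} {Q : NSOperad.{u, w} K}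
    (φ : Hom P Q) : Prop :=
  ∀ n, Function.Injective (φ.app n)

/-- Membership in the operadic ideal of `P` generated by the family of subsets `R`: the smallest
family of submodules that contains `R` and is stable under composition with arbitrary operations on
either side. -/
inductive IdealMem {K : Type u} [CommRing K] (P : NSOperad.{u, v} K) (R : ∀ n, Set (P.obj n)) :
    ∀ n, P.obj n → Prop
  | rel {n : ℕ} (x : P.obj n) : x ∈ R n → IdealMem P R n x
  | zero (n : ℕ) : IdealMem P R n 0
  | add {n : ℕ} (x y : P.obj n) : IdealMem P R n x → IdealMem P R n y → IdealMem P R n (x + y)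
  | smul {n : ℕ} (k : K) (x : P.obj n) : IdealMem P R n x → IdealMem P R n (k • x)
  | comp_left (a b : ℕ) {m n r : ℕ} (hm : m = a + 1 + b) (hr : r = a + n + b)
      (f : P.obj m) (g : P.obj n) : IdealMem P R m f → IdealMem P R r (P.comp a b hm hr f g)
  | comp_right (a b : ℕ) {m n r : ℕ} (hm : m = a + 1 + b) (hr : r = a + n + b)
      (f : P.obj m) (g : P.obj n) : IdealMem P R n g → IdealMem P R r (P.comp a b hm hr f g)

/-- The operadic ideal generated by `R`, in arity `n`. -/
def ideal {K : Type u} [CommRing K] (P : NSOperad.{u, v} K) (R : ∀ n, Set (P.obj n)) (n : ℕ) :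
    Submodule K (P.obj n) where
  carrier := {x | IdealMem P R n x}
  zero_mem' := IdealMem.zero n
  add_mem' := fun hx hy => IdealMem.add _ _ hx hy
  smul_mem' := fun k _ hx => IdealMem.smul k _ hx

/-- Partial composition on the quotient of `P` by the operadic ideal generated by `R`. -/
def quotientComp {K : Type u} [CommRing K] (P : NSOperad.{u, v} K) (R : ∀ n, Set (P.obj n))
    (a b : ℕ) {m n r : ℕ} (hm : m = a + 1 + b) (hr : r = a + n + b) :
    (P.obj m ⧸ P.ideal R m) →ₗ[K] (P.obj n ⧸ P.ideal R n) →ₗ[K] (P.obj r ⧸ P.ideal R r) :=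
  (P.ideal R m).liftQ
    { toFun := fun f => (P.ideal R n).mapQ (P.ideal R r) (P.comp a b hm hr f)
        (fun g hg => IdealMem.comp_right a b hm hr f g hg)
      map_add' := fun f f' => by
        refine Submodule.linearMap_qext _ (LinearMap.ext fun g => ?_)
        change Submodule.Quotient.mk (P.comp a b hm hr (f + f') g)
          = Submodule.Quotient.mk (P.comp a b hm hr f g + P.comp a b hm hr f' g)
        rw [map_add, LinearMap.add_apply]
      map_smul' := fun k f => by
        refine Submodule.linearMap_qext _ (LinearMap.ext fun g => ?_)
        change Submodule.Quotient.mk (P.comp a b hm hr (k • f) g)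
          = Submodule.Quotient.mk (k • P.comp a b hm hr f g)
        rw [map_smul, LinearMap.smul_apply] }
    (fun f hf => by
      rw [LinearMap.mem_ker]
      refine Submodule.linearMap_qext _ (LinearMap.ext fun g => ?_)
      exact (Submodule.Quotient.mk_eq_zero (P.ideal R r)).2
        (IdealMem.comp_left a b hm hr f g hf))

/-- The quotient of the ns operad `P` by the operadic ideal generated by `R`. -/
def quotient {K : Type u} [CommRing K] (P : NSOperad.{u, v} K) (R : ∀ n, Set (P.obj n)) :
    NSOperad.{u, v} K where
  obj n := P.obj n ⧸ P.ideal R n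
  one := Submodule.Quotient.mk P.one
  comp a b {_ _ _} hm hr := quotientComp P R a b hm hr
  one_comp h1 hn f := by
    obtain ⟨f, rfl⟩ := Submodule.Quotient.mk_surjective _ f
    exact congrArg Submodule.Quotient.mk (P.one_comp h1 hn f)
  comp_one a b _ hm hm' f := by
    obtain ⟨f, rfl⟩ := Submodule.Quotient.mk_surjective _ f
    exact congrArg Submodule.Quotient.mk (P.comp_one a b hm hm' f)
  comp_seq a b c d _ _ _ _ _ _ hl hm hq hr hq' hs hs' f g h := by
    obtain ⟨f, rfl⟩ := Submodule.Quotient.mk_surjective _ f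
    obtain ⟨g, rfl⟩ := Submodule.Quotient.mk_surjective _ g
    obtain ⟨h, rfl⟩ := Submodule.Quotient.mk_surjective _ h
    exact congrArg Submodule.Quotient.mk (P.comp_seq a b c d hl hm hq hr hq' hs hs' f g h)
  comp_par a b c _ _ _ _ _ _ hl hl' hq hq' hr hr' hs hs' f g h := by
    obtain ⟨f, rfl⟩ := Submodule.Quotient.mk_surjective _ f
    obtain ⟨g, rfl⟩ := Submodule.Quotient.mk_surjective _ g
    obtain ⟨h, rfl⟩ := Submodule.Quotient.mk_surjective _ h
    exact congrArg Submodule.Quotient.mk (P.comp_par a b c hl hl' hq hq' hr hr' hs hs' f g h)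

/-- The class in the quotient operad of an operation of `P`. -/
def quotientMk {K : Type u} [CommRing K] (P : NSOperad.{u, v} K) (R : ∀ n, Set (P.obj n))
    {n : ℕ} (x : P.obj n) : (P.quotient R).obj n :=
  (P.ideal R n).mkQ x

end NSOperad

/-! ### The free ns operad on a set of binary operations -/

/-- Planar binary trees whose internal vertices are labelled by `E`: the monomials in a family `E`
of binary operations, with the variables in their natural order. -/
inductive OpTree (E : Type w) : Type w
  | leaf : OpTree E
  | node : E → OpTree E → OpTree E → OpTree E

namespace OpTree

/-- The number of leaves. -/
def leaves {E : Type w} : OpTree E → ℕ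
  | leaf => 1
  | node _ s t => s.leaves + t.leaves

/-- `graft t a s` replaces by `s` the leaf of `t` that has exactly `a` leaves on its left
(meaningful for `a < t.leaves`). -/
def graft {E : Type w} : OpTree E → ℕ → OpTree E → OpTree E
  | leaf, _, s => s
  | node e t₁ t₂, a, s =>
      if a < t₁.leaves then node e (t₁.graft a s) t₂ else node e t₁ (t₂.graft (a - t₁.leaves) s)

theorem leaves_pos {E : Type w} (t : OpTree E) : 0 < t.leaves := by
  induction t with
  | leaf => simp [leaves]
  | node e t₁ t₂ ih₁ ih₂ => simp only [leaves]; omega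

theorem leaves_graft {E : Type w} (t : OpTree E) (a : ℕ) (s : OpTree E) (h : a < t.leaves) :
    (t.graft a s).leaves + 1 = t.leaves + s.leaves := by
  induction t generalizing a with
  | leaf => simp [graft, leaves]; omega
  | node e t₁ t₂ ih₁ ih₂ =>
    simp only [leaves] at h
    simp only [graft]
    split_ifs with h'
    · have := ih₁ a h'
      simp only [leaves]; omega
    · have := ih₂ (a - t₁.leaves) (by omega)
      simp only [leaves]; omega

theorem graft_leaf {E : Type w} (t : OpTree E) (a : ℕ) : t.graft a leaf = t := by
  induction t generalizing a with
  | leaf => rfl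
  | node e t₁ t₂ ih₁ ih₂ => simp [graft, ih₁, ih₂]

theorem graft_seq {E : Type w} (t s u : OpTree E) (a c : ℕ) (ha : a < t.leaves)
    (hc : c < s.leaves) : (t.graft a s).graft (a + c) u = t.graft a (s.graft c u) := by
  induction t generalizing a with
  | leaf =>
    have : a = 0 := by simp only [leaves] at ha; omega
    subst this
    simp [graft]
  | node e t₁ t₂ ih₁ ih₂ =>
    simp only [leaves] at ha
    by_cases h : a < t₁.leaves
    · have h1 := leaves_graft t₁ a s h
      have h2 : a + c < (t₁.graft a s).leaves := by omega
      simp [graft, h, h2, ih₁ a h]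
    · have h2 : ¬ a + c < t₁.leaves := by omega
      have h3 : a + c - t₁.leaves = (a - t₁.leaves) + c := by omega
      simp [graft, h, h2, h3, ih₂ (a - t₁.leaves) (by omega)]

theorem graft_par {E : Type w} (t s u : OpTree E) (a b : ℕ) (h : a + 1 + b < t.leaves) :
    (t.graft a s).graft (a + s.leaves + b) u = (t.graft (a + 1 + b) u).graft a s := by
  induction t generalizing a b with
  | leaf => simp only [leaves] at h; omega
  | node e t₁ t₂ ih₁ ih₂ =>
    simp only [leaves] at h
    by_cases h1 : a + 1 + b < t₁.leaves
    · have h2 : a < t₁.leaves := by omega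
      have h3 := leaves_graft t₁ a s h2
      have h4 := leaves_graft t₁ (a + 1 + b) u h1
      have hu := leaves_pos u
      have h5 : a + s.leaves + b < (t₁.graft a s).leaves := by omega
      have h6 : a < (t₁.graft (a + 1 + b) u).leaves := by omega
      simp [graft, h1, h2, h5, h6, ih₁ a b h1]
    · by_cases h2 : a < t₁.leaves
      · have h3 := leaves_graft t₁ a s h2
        have h5 : ¬ a + s.leaves + b < (t₁.graft a s).leaves := by omega
        have h6 : a + s.leaves + b - (t₁.graft a s).leaves = a + 1 + b - t₁.leaves := by omega
        simp [graft, h1, h2, h5, h6]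
      · have h5 : ¬ a + s.leaves + b < t₁.leaves := by omega
        have h6 : a + s.leaves + b - t₁.leaves = (a - t₁.leaves) + s.leaves + b := by omega
        have h7 : a + 1 + b - t₁.leaves = (a - t₁.leaves) + 1 + b := by omega
        simp [graft, h1, h2, h5, h6, h7, ih₂ (a - t₁.leaves) b (by omega)]

end OpTree

/-- Trees with exactly `n` leaves. -/
def OpTreeOf (E : Type w) (n : ℕ) : Type w := {t : OpTree E // t.leaves = n}

namespace OpTreeOf

/-- The tree with one leaf and no internal vertex. -/
def leaf {E : Type w} : OpTreeOf E 1 := ⟨OpTree.leaf, by simp [OpTree.leaves]⟩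

/-- The monomial `x e y`. -/
def gen {E : Type w} (e : E) : OpTreeOf E 2 :=
  ⟨OpTree.node e OpTree.leaf OpTree.leaf, by simp [OpTree.leaves]⟩

/-- The monomial `(x e y) f z`. -/
def left {E : Type w} (e f : E) : OpTreeOf E 3 :=
  ⟨OpTree.node f (OpTree.node e OpTree.leaf OpTree.leaf) OpTree.leaf, by simp [OpTree.leaves]⟩

/-- The monomial `x e (y f z)`. -/
def right {E : Type w} (e f : E) : OpTreeOf E 3 :=
  ⟨OpTree.node e OpTree.leaf (OpTree.node f OpTree.leaf OpTree.leaf), by simp [OpTree.leaves]⟩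

/-- Grafting with arities recorded: `s` is plugged into the leaf of `t` with `a` leaves on its left
and `b` on its right. -/
def graft {E : Type w} (a b : ℕ) {m n r : ℕ} (hm : m = a + 1 + b) (hr : r = a + n + b)
    (t : OpTreeOf E m) (s : OpTreeOf E n) : OpTreeOf E r :=
  ⟨t.1.graft a s.1, by
    have ht := t.2
    have hs := s.2
    have := OpTree.leaves_graft t.1 a s.1 (by omega)
    omega⟩

end OpTreeOf

/-- Partial composition in the free ns operad: the bilinear extension of grafting. -/
noncomputable def freeComp (K : Type u) [CommRing K] (E : Type w) (a b : ℕ) {m n r : ℕ}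
    (hm : m = a + 1 + b) (hr : r = a + n + b) :
    (OpTreeOf E m →₀ K) →ₗ[K] (OpTreeOf E n →₀ K) →ₗ[K] (OpTreeOf E r →₀ K) :=
  Finsupp.lsum K fun t =>
    LinearMap.toSpanSingleton K ((OpTreeOf E n →₀ K) →ₗ[K] (OpTreeOf E r →₀ K))
      (Finsupp.lmapDomain K K (OpTreeOf.graft a b hm hr t))

theorem freeComp_single (K : Type u) [CommRing K] (E : Type w) (a b : ℕ) {m n r : ℕ}
    (hm : m = a + 1 + b) (hr : r = a + n + b) (t : OpTreeOf E m) (s : OpTreeOf E n) (x y : K) :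
    freeComp K E a b hm hr (Finsupp.single t x) (Finsupp.single s y)
      = Finsupp.single (OpTreeOf.graft a b hm hr t s) (x * y) := by
  simp [freeComp, Finsupp.mapDomain_single]

/-- The free ns operad generated by the set `E` of binary operations. In arity `n` it is the free
module on the planar binary trees with `n` leaves and internal vertices labelled by `E`. -/
noncomputable def freeBinaryOperad (K : Type u) [CommRing K] (E : Type w) :
    NSOperad.{u, max u w} K where
  obj n := OpTreeOf E n →₀ K
  one := Finsupp.single OpTreeOf.leaf 1
  comp a b {_ _ _} hm hr := freeComp K E a b hm hr
  one_comp h1 hn f := by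
    induction f using Finsupp.induction_linear with
    | zero => simp
    | add f g hf hg => simp [hf, hg]
    | single t x =>
      rw [freeComp_single, one_mul]
      rfl
  comp_one a b _ hm hm' f := by
    induction f using Finsupp.induction_linear with
    | zero => simp
    | add f g hf hg => simp [hf, hg]
    | single t x =>
      rw [freeComp_single, mul_one]
      congr 1
      exact Subtype.ext (OpTree.graft_leaf t.1 a)
  comp_seq a b c d _ _ _ _ _ _ hl hm hq hr hq' hs hs' f g h := by
    induction f using Finsupp.induction_linear with
    | zero => simp
    | add f f' hf hf' => simp [hf, hf']
    | single t x =>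
      induction g using Finsupp.induction_linear with
      | zero => simp
      | add g g' hg hg' => simp [hg, hg']
      | single s y =>
        induction h using Finsupp.induction_linear with
        | zero => simp
        | add h h' hh hh' => simp [hh, hh']
        | single w z =>
          simp only [freeComp_single, mul_assoc]
          congr 1
          have ht := t.2
          have hs := s.2
          exact Subtype.ext (OpTree.graft_seq t.1 s.1 w.1 a c (by omega) (by omega))
  comp_par a b c _ _ _ _ _ _ hl hl' hq hq' hr hr' hs hs' f g h := by
    induction f using Finsupp.induction_linear with
    | zero => simp
    | add f f' hf hf' => simp [hf, hf']
    | single t x =>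
      induction g using Finsupp.induction_linear with
      | zero => simp
      | add g g' hg hg' => simp [hg, hg']
      | single s y =>
        induction h using Finsupp.induction_linear with
        | zero => simp
        | add h h' hh hh' => simp [hh, hh']
        | single w z =>
          simp only [freeComp_single, mul_assoc, mul_comm z y]
          congr 1
          have ht := t.2
          have hs := s.2
          have := OpTree.graft_par t.1 s.1 w.1 a b (by omega)
          rw [hs] at this
          exact Subtype.ext this

/-- The generating operation `x e y` of the free operad. -/
noncomputable def freeGen (K : Type u) [CommRing K] {E : Type w} (e : E) :
    (freeBinaryOperad K E).obj 2 :=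
  Finsupp.single (OpTreeOf.gen e) (1 : K)

/-- The ternary operation `(x e y) f z` of the free operad. -/
noncomputable def freeLeft (K : Type u) [CommRing K] {E : Type w} (e f : E) :
    (freeBinaryOperad K E).obj 3 :=
  Finsupp.single (OpTreeOf.left e f) (1 : K)

/-- The ternary operation `x e (y f z)` of the free operad. -/
noncomputable def freeRight (K : Type u) [CommRing K] {E : Type w} (e f : E) :
    (freeBinaryOperad K E).obj 3 :=
  Finsupp.single (OpTreeOf.right e f) (1 : K)

/-! ### The operads `Mag` and `Dend` -/

/-- The single generating operation of magmatic algebras. -/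
inductive MagOp : Type
  | box

/-- The two generating operations of dendriform algebras. -/
inductive DendOp : Type
  | prec
  | succ

/-- The ns operad `Mag` of magmatic algebras: one binary operation, no relation. -/
noncomputable def Mag (K : Type u) [CommRing K] : NSOperad.{u, u} K := freeBinaryOperad K MagOp

/-- The generating operation `□` of `Mag`. -/
noncomputable def Mag.box (K : Type u) [CommRing K] : (Mag K).obj 2 := freeGen K MagOp.box

open DendOp in
/-- The three relators of dendriform algebras:
* `(x ≺ y) ≺ z = x ≺ (y ≺ z) + x ≺ (y ≻ z)`,
* `(x ≻ y) ≺ z = x ≻ (y ≺ z)`,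
* `(x ≺ y) ≻ z + (x ≻ y) ≻ z = x ≻ (y ≻ z)`. -/
inductive DendRel (K : Type u) [CommRing K] : ∀ n, (freeBinaryOperad K DendOp).obj n → Prop
  | rel₁ : DendRel K 3
      (freeLeft K prec prec - (freeRight K prec prec + freeRight K prec succ))
  | rel₂ : DendRel K 3 (freeLeft K succ prec - freeRight K succ prec)
  | rel₃ : DendRel K 3
      (freeLeft K prec succ + freeLeft K succ succ - freeRight K succ succ)

/-- The ns operad `Dend` of dendriform algebras: the free ns operad on `≺`, `≻` modulo the operadic
ideal generated by the dendriform relators. -/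
noncomputable def Dend (K : Type u) [CommRing K] : NSOperad.{u, u} K :=
  (freeBinaryOperad K DendOp).quotient fun n => {x | DendRel K n x}

/-- The operation `≺` of `Dend`. -/
noncomputable def Dend.prec (K : Type u) [CommRing K] : (Dend K).obj 2 :=
  (freeBinaryOperad K DendOp).quotientMk _ (freeGen K DendOp.prec)

/-- The operation `≻` of `Dend`. -/
noncomputable def Dend.succ (K : Type u) [CommRing K] : (Dend K).obj 2 :=
  (freeBinaryOperad K DendOp).quotientMk _ (freeGen K DendOp.succ)

/-! ### Dendriform algebras -/

/-! Existence and uniqueness are the universal property of the free operad (`freeBinaryOperad.lift`,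
`hom_eq_lift`). For injectivity it suffices to find one dendriform algebra and one element x at
which the magmatic monomials with n leaves, computed with ≺ - ≻, take linearly independent values.
The Loday–Ronco algebra of planar binary trees works, with x the one-node tree; its freeness is not
needed.

In a dendriform algebra * = ≺ + ≻ is associative. Call a *-product of magmatic monomials at x a
word. The key fact is `prec_word_sub_mem`: in characteristic 0, if u and v are words of lengths p
and q, then u ≺ v equals p/(p+q) u*v modulo shorter words of the same degree. For single letters, t
≺ s = ½(t*s + t□s) and t□s is again a letter; longer words follow by induction from the dendriform
relations. Hence the span of the words is stable under ≺ and ≻, and since the one-node tree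
generates, it contains every nonempty tree (`single_mem_wordSpan`).

Words of degree n are indexed by planar forests with n leaves, and there are at most as many of
these as trees with n nodes (`exists_injective_forests_trees`). A family whose span has dimension at
least its cardinality is independent, so the words are independent (`linearIndependent_word`), in
particular those of length one, which are the magmatic monomials. -/

/-- A dendriform algebra structure on a module. -/
structure DendriformAlgebra (K : Type u) [CommRing K] (A : Type v) [AddCommGroup A]
    [Module K A] where
  /-- the left operation `≺` -/
  prec : A →ₗ[K] A →ₗ[K] A
  /-- the right operation `≻` -/
  succ : A →ₗ[K] A →ₗ[K] A
  prec_prec : ∀ x y z, prec (prec x y) z = prec x (prec y z + succ y z)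
  succ_prec : ∀ x y z, prec (succ x y) z = succ x (prec y z)
  succ_succ : ∀ x y z, succ (prec x y + succ x y) z = succ x (succ y z)

namespace DendriformAlgebra

variable {K : Type u} [CommRing K] {A : Type v} [AddCommGroup A] [Module K A]
  (D : DendriformAlgebra K A)

/-- The associative product `≺ + ≻`. -/
def star : A →ₗ[K] A →ₗ[K] A := D.prec + D.succ

theorem star_apply (x y : A) : D.star x y = D.prec x y + D.succ x y := rfl

/-- This is the sum of the three dendriform relations. -/
theorem star_assoc (x y z : A) : D.star (D.star x y) z = D.star x (D.star y z) := by
  simp only [D.star_apply (D.star x y) z, D.star_apply x (D.star y z)]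
  have h₁ := D.prec_prec x y z
  have h₂ := D.succ_prec x y z
  have h₃ := D.succ_succ x y z
  rw [star_apply, star_apply, h₃, ← h₁, map_add, map_add, LinearMap.add_apply, h₂, add_assoc]

/-- The bilinear operation of a dendriform algebra attached to a generator of `Dend`. -/
def op : DendOp → A →ₗ[K] A →ₗ[K] A
  | DendOp.prec => D.prec
  | DendOp.succ => D.succ

end DendriformAlgebra

/-! ### The Loday–Ronco algebra -/

namespace LodayRonco

open BinaryTree

variable (K : Type u) [CommRing K]

/-- Bilinear extension of an operation on planar binary trees. -/
noncomputable def extend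
    (f : BinaryTree Unit → BinaryTree Unit → (BinaryTree Unit →₀ K)) :
    (BinaryTree Unit →₀ K) →ₗ[K] (BinaryTree Unit →₀ K) →ₗ[K] (BinaryTree Unit →₀ K) :=
  Finsupp.linearCombination K fun t => Finsupp.linearCombination K (f t)

/-- The bilinear extension of the grafting of two trees on a common root. -/
noncomputable def join :
    (BinaryTree Unit →₀ K) →ₗ[K] (BinaryTree Unit →₀ K) →ₗ[K] (BinaryTree Unit →₀ K) :=
  extend K fun l r => Finsupp.single (node () l r) 1

/-- The Loday–Ronco product of two planar binary trees. -/
noncomputable def starTree : BinaryTree Unit → BinaryTree Unit → (BinaryTree Unit →₀ K)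
  | nil, s => Finsupp.single s 1
  | node _ l r, nil => Finsupp.single (node () l r) 1
  | node _ l r, node _ l' r' =>
      join K (Finsupp.single l 1) (starTree r (node () l' r')) +
        join K (starTree (node () l r) l') (Finsupp.single r' 1)
termination_by t s => t.numNodes + s.numNodes
decreasing_by all_goals simp only [numNodes]; omega

/-- The left half of the Loday–Ronco product, with the convention that the unit is `≺`-idempotent. -/
noncomputable def precTree : BinaryTree Unit → BinaryTree Unit → (BinaryTree Unit →₀ K)
  -- The usual theory leaves 1 ≺ 1 undefined. With this value, and 1 ≻ 1 = 0, the empty tree is a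
  -- unit for the sum of the two halves and the dendriform relations hold on the whole space.
  | nil, nil => Finsupp.single nil 1
  | nil, node _ _ _ => 0
  | node _ l r, s => join K (Finsupp.single l 1) (starTree K r s)

/-- The right half of the Loday–Ronco product. -/
noncomputable def succTree : BinaryTree Unit → BinaryTree Unit → (BinaryTree Unit →₀ K)
  | _, nil => 0
  | t, node _ l r => join K (starTree K t l) (Finsupp.single r 1)

variable {K}

@[simp]
theorem extend_single_single (f : BinaryTree Unit → BinaryTree Unit → (BinaryTree Unit →₀ K))
    (t s : BinaryTree Unit) :
    extend K f (Finsupp.single t 1) (Finsupp.single s 1) = f t s := by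
  simp [extend]

@[simp]
theorem join_single_single (t s : BinaryTree Unit) :
    join K (Finsupp.single t 1) (Finsupp.single s 1) = Finsupp.single (node () t s) 1 := by
  simp [join]

theorem starTree_nil_right (t : BinaryTree Unit) : starTree K t nil = Finsupp.single t 1 := by
  cases t <;> simp [starTree]

theorem precTree_add_succTree (t s : BinaryTree Unit) :
    precTree K t s + succTree K t s = starTree K t s := by
  cases t <;> cases s <;> simp [precTree, succTree, starTree, starTree_nil_right]

theorem star_eq_prec_add_succ (x y : BinaryTree Unit →₀ K) :
    extend K (starTree K) x y = extend K (precTree K) x y + extend K (succTree K) x y := by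
  have : extend K (starTree K) = extend K (precTree K) + extend K (succTree K) := by
    ext t s : 4
    simp [precTree_add_succTree]
  rw [this]
  rfl

theorem single_induction {p : (BinaryTree Unit →₀ K) → Prop} (x : BinaryTree Unit →₀ K)
    (zero : p 0) (add : ∀ x y, p x → p y → p (x + y)) (smul : ∀ (a : K) x, p x → p (a • x))
    (single : ∀ t, p (Finsupp.single t 1)) : p x := by
  induction x using Finsupp.induction_linear with
  | zero => exact zero
  | add f g hf hg => exact add f g hf hg
  | single t a =>
    rw [← mul_one a, ← smul_eq_mul, ← Finsupp.smul_single]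
    exact smul a _ (single t)

/-! ### The empty tree as unit, and the half-products of joined trees. -/

@[simp]
theorem star_nil_left (x : BinaryTree Unit →₀ K) :
    extend K (starTree K) (Finsupp.single nil 1) x = x := by
  induction x using single_induction with
  | zero => simp
  | add x y hx hy => rw [map_add, hx, hy]
  | smul a x hx => rw [map_smul, hx]
  | single t => simp [starTree]

@[simp]
theorem star_nil_right (x : BinaryTree Unit →₀ K) :
    extend K (starTree K) x (Finsupp.single nil 1) = x := by
  induction x using single_induction with
  | zero => simp
  | add x y hx hy => rw [map_add, LinearMap.add_apply, hx, hy]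
  | smul a x hx => rw [map_smul, LinearMap.smul_apply, hx]
  | single t => simp [starTree_nil_right]

/-- Bilinear form of the recursion: ≺ acts only inside the right branch of its left argument. With
the mirror rule `succ_join`, it replaces all further unfolding of the product on nonempty trees. -/
theorem prec_join (x y z : BinaryTree Unit →₀ K) :
    extend K (precTree K) (join K x y) z = join K x (extend K (starTree K) y z) := by
  induction x using single_induction with
  | zero => simp
  | add x x' hx hx' => simp only [map_add, LinearMap.add_apply, hx, hx']
  | smul a x hx => simp only [map_smul, LinearMap.smul_apply, hx]
  | single t =>
  induction y using single_induction with
  | zero => simp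
  | add x x' hx hx' => simp only [map_add, LinearMap.add_apply, hx, hx']
  | smul a x hx => simp only [map_smul, LinearMap.smul_apply, hx]
  | single s =>
  induction z using single_induction with
  | zero => simp
  | add x x' hx hx' => simp only [map_add, hx, hx']
  | smul a x hx => simp only [map_smul, hx]
  | single u => simp [precTree]

theorem succ_join (x y z : BinaryTree Unit →₀ K) :
    extend K (succTree K) x (join K y z) = join K (extend K (starTree K) x y) z := by
  induction z using single_induction with
  | zero => simp
  | add x x' hx hx' => simp only [map_add, hx, hx']
  | smul a x hx => simp only [map_smul, hx]
  | single t =>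
  induction y using single_induction with
  | zero => simp
  | add x x' hx hx' => simp only [map_add, LinearMap.add_apply, hx, hx']
  | smul a x hx => simp only [map_smul, LinearMap.smul_apply, hx]
  | single s =>
  induction x using single_induction with
  | zero => simp
  | add x x' hx hx' => simp only [map_add, LinearMap.add_apply, hx, hx']
  | smul a x hx => simp only [map_smul, LinearMap.smul_apply, hx]
  | single u => simp [succTree]

theorem prec_nil_join (x y : BinaryTree Unit →₀ K) :
    extend K (precTree K) (Finsupp.single nil 1) (join K x y) = 0 := by
  induction x using single_induction with
  | zero => simp
  | add x x' hx hx' => simp only [map_add, LinearMap.add_apply, hx, hx', add_zero]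
  | smul a x hx => simp only [map_smul, LinearMap.smul_apply, hx, smul_zero]
  | single t =>
  induction y using single_induction with
  | zero => simp
  | add x x' hx hx' => simp only [map_add, hx, hx', add_zero]
  | smul a x hx => simp only [map_smul, hx, smul_zero]
  | single s => simp [precTree]

theorem succ_nil_right (x : BinaryTree Unit →₀ K) :
    extend K (succTree K) x (Finsupp.single nil 1) = 0 := by
  induction x using single_induction with
  | zero => simp
  | add x x' hx hx' => simp only [map_add, LinearMap.add_apply, hx, hx', add_zero]
  | smul a x hx => simp only [map_smul, LinearMap.smul_apply, hx, smul_zero]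
  | single t => simp [succTree]

theorem prec_nil_nil :
    extend K (precTree K) (Finsupp.single nil 1) (Finsupp.single nil 1) =
      Finsupp.single nil 1 := by
  simp [precTree]

theorem single_node (l r : BinaryTree Unit) :
    (Finsupp.single (node () l r) 1 : BinaryTree Unit →₀ K) =
      join K (Finsupp.single l 1) (Finsupp.single r 1) := by
  simp

/-- For nonempty trees both bracketings split as x ≺ (y*z) + x ≻ y ≺ z + (x*y) ≻ z. The middle term
is unambiguous by the join rules; the outer two need associativity only with x replaced by its right
branch, or z by its left branch. -/
theorem star_assoc_single (x y z : BinaryTree Unit) :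
    extend K (starTree K) (extend K (starTree K) (Finsupp.single x 1) (Finsupp.single y 1))
        (Finsupp.single z 1) =
      extend K (starTree K) (Finsupp.single x 1)
        (extend K (starTree K) (Finsupp.single y 1) (Finsupp.single z 1)) := by
  match x, y, z with
  | nil, y, z => rw [star_nil_left, star_nil_left]
  | x, nil, z => rw [star_nil_left, star_nil_right]
  | x, y, nil => rw [star_nil_right, star_nil_right]
  | node () l₁ r₁, node () l₂ r₂, node () l₃ r₃ =>
    have h₁ := star_assoc_single r₁ (node () l₂ r₂) (node () l₃ r₃)
    have h₃ := star_assoc_single (node () l₁ r₁) (node () l₂ r₂) l₃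
    simp only [star_eq_prec_add_succ (extend K (starTree K) _ _),
      star_eq_prec_add_succ _ (extend K (starTree K) _ _)]
    rw [single_node l₃ r₃, succ_join, h₃, ← single_node l₃ r₃,
      star_eq_prec_add_succ (Finsupp.single (node () l₁ r₁) 1),
      star_eq_prec_add_succ (Finsupp.single (node () l₂ r₂) 1) (Finsupp.single (node () l₃ r₃) 1),
      single_node l₁ r₁, prec_join, prec_join]
    simp only [map_add, LinearMap.add_apply]
    rw [prec_join, h₁, star_eq_prec_add_succ (Finsupp.single (node () l₂ r₂) 1), map_add, map_add,
      ← single_node l₁ r₁, single_node l₂ r₂, succ_join, prec_join, prec_join, succ_join,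
      single_node l₃ r₃, succ_join, succ_join]
    abel
termination_by x.numNodes + y.numNodes + z.numNodes
decreasing_by all_goals simp only [numNodes]; omega

theorem star_assoc (x y z : BinaryTree Unit →₀ K) :
    extend K (starTree K) (extend K (starTree K) x y) z =
      extend K (starTree K) x (extend K (starTree K) y z) := by
  induction x using single_induction with
  | zero => simp
  | add x x' hx hx' => simp only [map_add, LinearMap.add_apply, hx, hx']
  | smul a x hx => simp only [map_smul, LinearMap.smul_apply, hx]
  | single t =>
  induction y using single_induction with
  | zero => simp
  | add x x' hx hx' => simp only [map_add, LinearMap.add_apply, hx, hx']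
  | smul a x hx => simp only [map_smul, LinearMap.smul_apply, hx]
  | single s =>
  induction z using single_induction with
  | zero => simp
  | add x x' hx hx' => simp only [map_add, hx, hx']
  | smul a x hx => simp only [map_smul, hx]
  | single u => exact star_assoc_single t s u

variable (K)

/-- The Loday–Ronco dendriform algebra on planar binary trees. -/
noncomputable def dendriform : DendriformAlgebra K (BinaryTree Unit →₀ K) where
  prec := extend K (precTree K)
  succ := extend K (succTree K)
  prec_prec x y z := by
    rw [← star_eq_prec_add_succ]
    induction x using single_induction with
    | zero => simp
    | add x x' hx hx' => simp only [map_add, LinearMap.add_apply, hx, hx']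
    | smul a x hx => simp only [map_smul, LinearMap.smul_apply, hx]
    | single t =>
    -- For x nonempty both sides move into its right branch, where the relation is associativity of
    -- the product. The remaining cases, with x empty, are settled by the unit conventions.
    cases t with
    | node _ l r => rw [single_node, prec_join, prec_join, prec_join, star_assoc]
    | nil =>
    induction y using single_induction with
    | zero => simp
    | add x x' hx hx' => simp only [map_add, LinearMap.add_apply, hx, hx']
    | smul a x hx => simp only [map_smul, LinearMap.smul_apply, hx]
    | single s =>
    cases s with
    | nil => rw [prec_nil_nil, star_nil_left]
    | node _ l r =>
    rw [single_node, prec_nil_join, map_zero, LinearMap.zero_apply, star_eq_prec_add_succ,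
      prec_join, map_add, prec_nil_join, zero_add]
    induction z using single_induction with
    | zero => simp
    | add x x' hx hx' => simp only [map_add, ← hx, ← hx', add_zero]
    | smul a x hx => simp only [map_smul, ← hx, smul_zero]
    | single u =>
    cases u with
    | nil => rw [succ_nil_right, map_zero]
    | node _ l' r' => rw [single_node l' r', succ_join, prec_nil_join]
  succ_prec x y z := by
    induction y using single_induction with
    | zero => simp
    | add x x' hx hx' => simp only [map_add, LinearMap.add_apply, hx, hx']
    | smul a x hx => simp only [map_smul, LinearMap.smul_apply, hx]
    | single t =>
    -- For y nonempty the two operations act on different branches of y, so they commute without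
    -- using associativity.
    cases t with
    | node _ l r => rw [single_node, prec_join, succ_join, succ_join, prec_join]
    | nil =>
    rw [succ_nil_right, map_zero, LinearMap.zero_apply]
    induction z using single_induction with
    | zero => simp
    | add x x' hx hx' => simp only [map_add, ← hx, ← hx', add_zero]
    | smul a x hx => simp only [map_smul, ← hx, smul_zero]
    | single u =>
    cases u with
    | nil => rw [prec_nil_nil, succ_nil_right]
    | node _ l' r' => rw [single_node l' r', prec_nil_join, map_zero]
  succ_succ x y z := by
    rw [← star_eq_prec_add_succ]
    induction z using single_induction with
    | zero => simp
    | add x x' hx hx' => simp only [map_add, hx, hx']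
    | smul a x hx => simp only [map_smul, hx]
    | single t =>
    cases t with
    | nil => rw [succ_nil_right, succ_nil_right, map_zero]
    | node _ l r => rw [single_node, succ_join, succ_join, succ_join, star_assoc]

theorem dendriform_prec : (dendriform K).prec = extend K (precTree K) := rfl

theorem dendriform_succ : (dendriform K).succ = extend K (succTree K) := rfl

/-! ### Generation of the nonempty trees by the one-node tree. -/

/-- The tree with one node. -/
noncomputable def gen : BinaryTree Unit →₀ K := Finsupp.single (node () nil nil) 1

theorem single_node_eq (l r : BinaryTree Unit) :
    (Finsupp.single (node () l r) 1 : BinaryTree Unit →₀ K) =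
      (dendriform K).succ (Finsupp.single l 1)
        ((dendriform K).prec (gen K) (Finsupp.single r 1)) := by
  rw [dendriform_prec, dendriform_succ, gen, single_node nil nil, prec_join, succ_join, star_nil_left,
    star_nil_right, single_node]

theorem single_node_nil_eq (r : BinaryTree Unit) :
    (Finsupp.single (node () nil r) 1 : BinaryTree Unit →₀ K) =
      (dendriform K).prec (gen K) (Finsupp.single r 1) := by
  rw [dendriform_prec, gen, single_node nil nil, prec_join, star_nil_left, single_node]

theorem single_node_nil_right_eq (l : BinaryTree Unit) :
    (Finsupp.single (node () l nil) 1 : BinaryTree Unit →₀ K) =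
      (dendriform K).succ (Finsupp.single l 1) (gen K) := by
  rw [dendriform_succ, gen, single_node nil nil, succ_join, star_nil_right, single_node]

end LodayRonco

/-! ### Words of magmatic monomials in a dendriform algebra -/

/-- The total number of leaves of a planar forest. -/
def forestLeaves (l : List (OpTree MagOp)) : ℕ := (l.map OpTree.leaves).sum

theorem forestLeaves_cons (t : OpTree MagOp) (l : List (OpTree MagOp)) :
    forestLeaves (t :: l) = t.leaves + forestLeaves l := by
  simp [forestLeaves]

theorem forestLeaves_append (l l' : List (OpTree MagOp)) :
    forestLeaves (l ++ l') = forestLeaves l + forestLeaves l' := by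
  simp [forestLeaves]

namespace DendriformAlgebra

section Words

variable {K : Type u} [CommRing K] {A : Type v} [AddCommGroup A] [Module K A]
  (D : DendriformAlgebra K A) (x : A)

/-- The value at `x` of a magmatic monomial, for the operation `≺ - ≻`. -/
def magEval : OpTree MagOp → A
  | OpTree.leaf => x
  | OpTree.node _ s t => D.prec (magEval s) (magEval t) - D.succ (magEval s) (magEval t)

/-- The product of the values of the magmatic monomials in a nonempty forest. -/
def word : List (OpTree MagOp) → A
  | [] => 0
  | [t] => D.magEval x t
  | t :: s :: l => D.star (D.magEval x t) (word (s :: l))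

theorem word_cons (t : OpTree MagOp) {l : List (OpTree MagOp)} (hl : l ≠ []) :
    D.word x (t :: l) = D.star (D.magEval x t) (D.word x l) := by
  cases l with
  | nil => exact absurd rfl hl
  | cons s l => rfl

theorem word_append {l l' : List (OpTree MagOp)} (hl : l ≠ []) (hl' : l' ≠ []) :
    D.word x (l ++ l') = D.star (D.word x l) (D.word x l') := by
  induction l with
  | nil => exact absurd rfl hl
  | cons t l ih =>
    rcases eq_or_ne l [] with rfl | h
    · exact D.word_cons x t hl'
    · rw [List.cons_append, word_cons _ _ _ (by simp [h]), word_cons _ _ _ h, ih h, star_assoc]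

/-- The span of the words of length at most `N` and degree `n`. -/
def wordSpan (N n : ℕ) : Submodule K A :=
  Submodule.span K {a | ∃ l, l ≠ [] ∧ l.length ≤ N ∧ forestLeaves l = n ∧ D.word x l = a}

variable {D x}

theorem word_mem_wordSpan {N n : ℕ} {l : List (OpTree MagOp)} (hl : l ≠ []) (hN : l.length ≤ N)
    (hn : forestLeaves l = n) : D.word x l ∈ D.wordSpan x N n :=
  Submodule.subset_span ⟨l, hl, hN, hn, rfl⟩

theorem wordSpan_mono {N N' : ℕ} (h : N ≤ N') (n : ℕ) : D.wordSpan x N n ≤ D.wordSpan x N' n :=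
  Submodule.span_mono fun _ ⟨l, hl, hN, hn, e⟩ => ⟨l, hl, hN.trans h, hn, e⟩

theorem apply_mem_wordSpan (B : A →ₗ[K] A →ₗ[K] A) {i j m n k d : ℕ}
    (h : ∀ u v, u ≠ [] → v ≠ [] → u.length ≤ i → v.length ≤ j → forestLeaves u = m →
      forestLeaves v = n → B (D.word x u) (D.word x v) ∈ D.wordSpan x k d)
    {a b : A} (ha : a ∈ D.wordSpan x i m) (hb : b ∈ D.wordSpan x j n) :
    B a b ∈ D.wordSpan x k d := by
  have hab := Submodule.apply_mem_map₂ B ha hb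
  rw [wordSpan, wordSpan, Submodule.map₂_span_span] at hab
  refine Submodule.span_le.2 ?_ hab
  rintro _ ⟨_, ⟨u, hu, hui, hum, rfl⟩, _, ⟨v, hv, hvj, hvn, rfl⟩, rfl⟩
  exact h u v hu hv hui hvj hum hvn

theorem star_mem_wordSpan {i j m n : ℕ} {a b : A} (ha : a ∈ D.wordSpan x i m)
    (hb : b ∈ D.wordSpan x j n) : D.star a b ∈ D.wordSpan x (i + j) (m + n) := by
  refine apply_mem_wordSpan D.star (fun u v hu hv hui hvj hum hvn => ?_) ha hb
  rw [← D.word_append x hu hv]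
  refine word_mem_wordSpan (by simp [hu]) ?_ (by rw [forestLeaves_append, hum, hvn])
  rw [List.length_append]
  omega

end Words

/-! ### Leading terms of the half-products on words, in characteristic zero. -/

section Field

variable {K : Type u} [Field K] [CharZero K] {A : Type v} [AddCommGroup A] [Module K A]
  {D : DendriformAlgebra K A} {x : A}

/-- The linear algebra behind the leading term of `≺` on a product of three words. -/
theorem mem_of_leading_relations (S : Submodule K A) {p q r : ℕ} (hp : p ≠ 0) (hq : q ≠ 0)
    (hr : r ≠ 0) {e₁ e₂ w : A}
    (h₁ : e₁ - ((p : K) / (p + q : ℕ)) • e₂ ∈ S)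
    (h₂ : ((q : K) / (p + q : ℕ)) • e₂ - ((q : K) / (q + r : ℕ)) • (w - e₁) ∈ S) :
    e₁ - ((p : K) / (p + (q + r) : ℕ)) • w ∈ S ∧
      e₂ - ((p + q : ℕ) / (p + q + r : ℕ) : K) • w ∈ S := by
  have hp' : (p : K) ≠ 0 := Nat.cast_ne_zero.2 hp
  have hq' : (q : K) ≠ 0 := Nat.cast_ne_zero.2 hq
  have hpq : (p : K) + q ≠ 0 := by exact_mod_cast (by omega : p + q ≠ 0)
  have hqr : (q : K) + r ≠ 0 := by exact_mod_cast (by omega : q + r ≠ 0)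
  have hpqr : (p : K) + q + r ≠ 0 := by exact_mod_cast (by omega : p + q + r ≠ 0)
  have hpqr' : (p : K) + (q + r) ≠ 0 := by rwa [← add_assoc]
  push_cast at *
  constructor
  -- The hypotheses are two linear equations in `e₁` and `e₂` modulo `S`. The multipliers here
  -- eliminate `e₂`; those of the second part eliminate `e₁`.
  · convert S.add_mem (S.smul_mem (((q : K) + r) / (p + q + r)) h₁)
      (S.smul_mem ((p : K) * (q + r) / (q * (p + q + r))) h₂) using 1
    match_scalars <;> field_simp <;> ring
  · convert S.add_mem (S.smul_mem (-((p : K) + q) / (p + q + r)) h₁)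
      (S.smul_mem (((p : K) + q) * (q + r) / (q * (p + q + r))) h₂) using 1
    match_scalars <;> field_simp <;> ring

/-- Modulo shorter words, `u ≺ v` is `|u| / (|u| + |v|)` times the concatenation of `u` and `v`. -/
theorem prec_word_sub_mem (N : ℕ) : ∀ u v : List (OpTree MagOp), u ≠ [] → v ≠ [] →
    u.length + v.length = N + 1 →
    D.prec (D.word x u) (D.word x v) -
      ((u.length : K) / (u.length + v.length : ℕ)) • D.word x (u ++ v) ∈
        D.wordSpan x N (forestLeaves u + forestLeaves v) := by
  induction N using Nat.strong_induction_on with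
  | _ N ih =>
  -- The induction hypothesis shows that ≺ respects the length filtration as long as the total
  -- length is at most `N`; it is then applied to error terms.
  have hprec : ∀ {i j m n k d : ℕ} {a b : A}, i + j = k → m + n = d → k ≤ N →
      a ∈ D.wordSpan x i m → b ∈ D.wordSpan x j n → D.prec a b ∈ D.wordSpan x k d := by
    intro i j m n k d a b hk hd hN
    refine apply_mem_wordSpan D.prec fun u v hu hv hui hvj hum hvn => ?_
    have hu' := List.length_pos_of_ne_nil hu
    have hv' := List.length_pos_of_ne_nil hv
    have h := ih (u.length + v.length - 1) (by omega) u v hu hv (by omega)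
    rw [hum, hvn, hd] at h
    rw [← sub_add_cancel (D.prec _ _) (((u.length : K) / (u.length + v.length : ℕ)) •
      D.word x (u ++ v))]
    refine add_mem (wordSpan_mono (by omega) _ h) (Submodule.smul_mem _ _ ?_)
    refine word_mem_wordSpan (by simp [hu]) ?_ (by rw [forestLeaves_append, hum, hvn, hd])
    rw [List.length_append]
    omega
  have hsucc : ∀ {i j m n k d : ℕ} {a b : A}, i + j = k → m + n = d → k ≤ N →
      a ∈ D.wordSpan x i m → b ∈ D.wordSpan x j n → D.succ a b ∈ D.wordSpan x k d := by
    intro i j m n k d a b hk hd hN ha hb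
    have h₁ := star_mem_wordSpan ha hb
    have h₂ := hprec hk hd hN ha hb
    rw [hk, hd] at h₁
    rw [← add_sub_cancel_left (D.prec a b) (D.succ a b), ← star_apply]
    exact sub_mem h₁ h₂
  -- Three words of total length `N + 1` give two equations for e₁ = y₁ ≺ (y₂*y₃) and e₂ = (y₁*y₂) ≺
  -- y₃. Applying ≺ y₃ to the known leading term of y₁ ≺ y₂ relates e₁ = (y₁ ≺ y₂) ≺ y₃ to e₂.
  -- Applying y₁ ≻ to that of y₂ ≺ y₃ relates e₂ - e₁ = y₁ ≻ (y₂ ≺ y₃) to y₁ ≻ (y₂*y₃) = w - e₁,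
  -- where w is the full product.
  have three : ∀ y₁ y₂ y₃ : List (OpTree MagOp), y₁ ≠ [] → y₂ ≠ [] → y₃ ≠ [] →
      y₁.length + y₂.length + y₃.length = N + 1 → _ := fun y₁ y₂ y₃ h₁ h₂ h₃ hN => by
    have p₁ := List.length_pos_of_ne_nil h₁
    have p₂ := List.length_pos_of_ne_nil h₂
    have p₃ := List.length_pos_of_ne_nil h₃
    have i₁ := ih (y₁.length + y₂.length - 1) (by omega) y₁ y₂ h₁ h₂ (by omega)
    have i₂ := ih (y₂.length + y₃.length - 1) (by omega) y₂ y₃ h₂ h₃ (by omega)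
    have m₁ : D.word x y₁ ∈ D.wordSpan x y₁.length (forestLeaves y₁) :=
      word_mem_wordSpan h₁ le_rfl rfl
    have m₃ : D.word x y₃ ∈ D.wordSpan x y₃.length (forestLeaves y₃) :=
      word_mem_wordSpan h₃ le_rfl rfl
    have k₁ := hprec (k := N) (by omega) rfl le_rfl i₁ m₃
    have k₂ := hsucc (k := N) (by omega) (add_assoc _ _ _).symm le_rfl m₁ i₂
    have r₁ := D.prec_prec (D.word x y₁) (D.word x y₂) (D.word x y₃)
    have r₂ := D.succ_prec (D.word x y₁) (D.word x y₂) (D.word x y₃)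
    have s₁ := D.star_apply (D.word x y₁) (D.word x y₂)
    have s₃ := D.star_apply (D.word x y₁) (D.star (D.word x y₂) (D.word x y₃))
    rw [← star_apply] at r₁
    rw [D.word_append x h₁ h₂] at k₁
    rw [D.word_append x h₂ h₃] at k₂
    refine mem_of_leading_relations
      (D.wordSpan x N (forestLeaves y₁ + forestLeaves y₂ + forestLeaves y₃))
      (e₁ := D.prec (D.word x y₁) (D.star (D.word x y₂) (D.word x y₃)))
      (e₂ := D.prec (D.star (D.word x y₁) (D.word x y₂)) (D.word x y₃))
      (w := D.star (D.word x y₁) (D.star (D.word x y₂) (D.word x y₃)))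
      p₁.ne' p₂.ne' p₃.ne' ?_ ?_
    · convert k₁ using 1
      rw [← r₁, map_sub, LinearMap.sub_apply, map_smul, LinearMap.smul_apply]
    · convert add_mem k₁ k₂ using 1
      have hs : D.succ (D.word x y₁) (D.word x y₂) = D.star (D.word x y₁) (D.word x y₂) -
        D.prec (D.word x y₁) (D.word x y₂) := by rw [s₁]; abel
      rw [hs, map_sub, LinearMap.sub_apply] at r₂
      have hc : ((y₁.length : K) / (y₁.length + y₂.length : ℕ)) =
          1 - ((y₂.length : K) / (y₁.length + y₂.length : ℕ)) := by
        have : ((y₁.length + y₂.length : ℕ) : K) ≠ 0 := Nat.cast_ne_zero.2 (by omega)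
        field_simp
        push_cast
        ring
      rw [s₃, hc]
      simp only [map_sub, map_smul, LinearMap.sub_apply, LinearMap.smul_apply, ← r₂, add_sub_cancel_left,
        sub_smul, one_smul]
      abel
  intro u v hu hv hN
  match u, v, hu, hv with
  | [t], [s], _, _ =>
    have h : N = 1 := by simpa using hN.symm
    subst h
    have hm : D.word x [OpTree.node MagOp.box t s] ∈
        D.wordSpan x 1 (forestLeaves [t] + forestLeaves [s]) :=
      word_mem_wordSpan (by simp) (by simp) (by simp [forestLeaves, OpTree.leaves])
    -- The error t ≺ s - ½ t*s is ½(t ≺ s - t ≻ s), half of a single magmatic monomial.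
    convert Submodule.smul_mem _ (1 / 2 : K) hm using 1
    simp only [List.length_singleton, List.cons_append, List.nil_append, word, star_apply, magEval]
    match_scalars <;> norm_num
  -- As soon as one factor has two letters, splitting off its first letter gives three words. A long
  -- right factor uses the formula for e₁; otherwise the left factor is long and e₂ is used.
  | u, b :: c :: v, hu, _ =>
    have h := (three u [b] (c :: v) hu (by simp) (by simp) (by simp at hN ⊢; omega)).1
    rw [← D.word_append x (l' := c :: v) (by simp) (by simp),
      ← D.word_append x hu (by simp)] at h
    simpa [forestLeaves_append, forestLeaves, add_assoc, add_comm, add_left_comm] using h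
  | b :: c :: u, [t], _, _ =>
    have h := (three [b] (c :: u) [t] (by simp) (by simp) (by simp)
      (by simp at hN ⊢; omega)).2
    rw [← star_assoc, ← D.word_append x (l := [b]) (by simp) (by simp),
      ← D.word_append x (by simp) (by simp)] at h
    simpa [forestLeaves_append, forestLeaves, add_assoc, add_comm, add_left_comm] using h

end Field

end DendriformAlgebra

/-! ### Independence of magmatic monomials in the Loday–Ronco algebra -/

namespace DendriformAlgebra

variable {K : Type u} [Field K] [CharZero K] {A : Type v} [AddCommGroup A] [Module K A]
  {D : DendriformAlgebra K A} {x : A}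

theorem prec_mem_wordSpan {i j m n : ℕ} {a b : A} (ha : a ∈ D.wordSpan x i m)
    (hb : b ∈ D.wordSpan x j n) : D.prec a b ∈ D.wordSpan x (i + j) (m + n) := by
  refine apply_mem_wordSpan D.prec (fun u v hu hv hui hvj hum hvn => ?_) ha hb
  have hu' := List.length_pos_of_ne_nil hu
  have h := prec_word_sub_mem (D := D) (x := x) (u.length + v.length - 1) u v hu hv (by omega)
  rw [hum, hvn] at h
  rw [← sub_add_cancel (D.prec _ _) (((u.length : K) / (u.length + v.length : ℕ)) •
    D.word x (u ++ v))]
  refine add_mem (wordSpan_mono (by omega) _ h) (Submodule.smul_mem _ _ ?_)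
  refine word_mem_wordSpan (by simp [hu]) ?_ (by rw [forestLeaves_append, hum, hvn])
  rw [List.length_append]
  omega

theorem succ_mem_wordSpan {i j m n : ℕ} {a b : A} (ha : a ∈ D.wordSpan x i m)
    (hb : b ∈ D.wordSpan x j n) : D.succ a b ∈ D.wordSpan x (i + j) (m + n) := by
  rw [← add_sub_cancel_left (D.prec a b) (D.succ a b), ← star_apply]
  exact sub_mem (star_mem_wordSpan ha hb) (prec_mem_wordSpan ha hb)

end DendriformAlgebra

/-! ### Counting planar forests by leaves against trees by nodes. -/

/-- A planar binary tree decomposes along its leftmost branch into a forest. -/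
theorem OpTree.exists_foldl_eq (t : OpTree MagOp) :
    ∃ l, l.foldl (OpTree.node MagOp.box) OpTree.leaf = t ∧ forestLeaves l + 1 = t.leaves := by
  induction t with
  | leaf => exact ⟨[], rfl, rfl⟩
  | node e s t ihs _ =>
    obtain ⟨l, rfl, hl⟩ := ihs
    refine ⟨l ++ [t], by simp, ?_⟩
    rw [forestLeaves_append, OpTree.leaves, ← hl]
    simp [forestLeaves]
    omega

/-- The planar forest coded by a planar binary tree. -/
def forestOfTree : BinaryTree Unit → List (OpTree MagOp)
  | BinaryTree.nil => []
  | BinaryTree.node _ l r =>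
      (forestOfTree l).foldl (OpTree.node MagOp.box) OpTree.leaf :: forestOfTree r

/-- The first tree of a forest, cut along its leftmost branch, is a forest with one leaf fewer: it
is coded by the left subtree, the rest of the forest by the right subtree, and the root accounts for
the lost leaf. -/
theorem exists_forestOfTree_eq (n : ℕ) : ∀ l : List (OpTree MagOp), forestLeaves l = n →
    ∃ t : BinaryTree Unit, t.numNodes = n ∧ forestOfTree t = l := by
  induction n using Nat.strong_induction_on with
  | _ n ih =>
  rintro (_ | ⟨t, l⟩) h
  · exact ⟨BinaryTree.nil, by simpa [forestLeaves] using h, rfl⟩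
  · obtain ⟨s, rfl, hs⟩ := t.exists_foldl_eq
    rw [forestLeaves_cons] at h
    obtain ⟨a, ha, rfl⟩ := ih (forestLeaves s) (by omega) s rfl
    obtain ⟨b, hb, rfl⟩ := ih (forestLeaves l) (by omega) l rfl
    exact ⟨BinaryTree.node () a b, by simp only [BinaryTree.numNodes]; omega, rfl⟩

/-- A section of the surjective coding is injective. The dimension count needs only this inequality.
-/
theorem exists_injective_forests_trees (n : ℕ) :
    ∃ f : {l : List (OpTree MagOp) // forestLeaves l = n} → BinaryTree.treesOfNumNodesEq n,
      Function.Injective f := by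
  choose f hf hf' using fun l : {l : List (OpTree MagOp) // forestLeaves l = n} =>
    exists_forestOfTree_eq n l.1 l.2
  refine ⟨fun l => ⟨f l, BinaryTree.mem_treesOfNumNodesEq.2 (hf l)⟩, fun l l' h => ?_⟩
  have h' : f l = f l' := congrArg Subtype.val h
  exact Subtype.ext (by rw [← hf' l, ← hf' l', h'])

namespace LodayRonco

open BinaryTree

variable (K : Type u) [Field K] [CharZero K]

/-- The tree with branches l, r is l ≻ (x ≺ r) with x the one-node tree, and word spans are stable
under both operations. Empty branches are dropped from this formula because the induction hypothesis
covers nonempty trees only. -/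
theorem single_mem_wordSpan (t : BinaryTree Unit) (ht : t ≠ nil) :
    Finsupp.single t 1 ∈ (dendriform K).wordSpan (gen K) t.numNodes t.numNodes := by
  have hx : gen K ∈ (dendriform K).wordSpan (gen K) 1 1 :=
    DendriformAlgebra.word_mem_wordSpan (l := [OpTree.leaf]) (by simp) (by simp) rfl
  induction t with
  | nil => exact absurd rfl ht
  | node _ l r ihl ihr =>
    have hr : ∀ h : r ≠ nil, (dendriform K).prec (gen K) (Finsupp.single r 1) ∈
        (dendriform K).wordSpan (gen K) (1 + r.numNodes) (1 + r.numNodes) :=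
      fun h => DendriformAlgebra.prec_mem_wordSpan hx (ihr h)
    rcases eq_or_ne l nil with rfl | hl <;> rcases eq_or_ne r nil with rfl | hr'
    · exact hx
    · rw [single_node_nil_eq]
      simpa only [numNodes, zero_add, add_comm] using hr hr'
    · rw [single_node_nil_right_eq]
      simpa only [numNodes, add_zero] using DendriformAlgebra.succ_mem_wordSpan (ihl hl) hx
    · rw [single_node_eq]
      simpa only [numNodes, add_assoc, add_comm, add_left_comm] using
        DendriformAlgebra.succ_mem_wordSpan (ihl hl) (hr hr')

/-- The words of positive degree `n` are linearly independent. -/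
theorem linearIndependent_word {n : ℕ} (hn : n ≠ 0) :
    LinearIndependent K fun l : {l : List (OpTree MagOp) // forestLeaves l = n} =>
      (dendriform K).word (gen K) l.1 := by
  obtain ⟨f, hf⟩ := exists_injective_forests_trees n
  have := Finite.of_injective f hf
  have := Fintype.ofFinite {l : List (OpTree MagOp) // forestLeaves l = n}
  -- Independence becomes a count: forests number at most the trees with n nodes, and these are
  -- independent vectors lying in the span of the words.
  rw [linearIndependent_iff_card_le_finrank_span]
  refine (Fintype.card_le_of_injective f hf).trans ?_
  have hli : LinearIndependent K fun t : treesOfNumNodesEq n =>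
      (Finsupp.single t.1 1 : BinaryTree Unit →₀ K) :=
    (Finsupp.linearIndependent_single_one K (BinaryTree Unit)).comp _ Subtype.val_injective
  rw [← finrank_span_eq_card hli]
  have hfin : FiniteDimensional K (Submodule.span K (Set.range fun l :
      {l : List (OpTree MagOp) // forestLeaves l = n} => (dendriform K).word (gen K) l.1)) :=
    FiniteDimensional.span_of_finite K (Set.finite_range _)
  refine Submodule.finrank_mono (Submodule.span_le.2 ?_)
  rintro _ ⟨⟨t, ht⟩, rfl⟩
  rw [mem_treesOfNumNodesEq] at ht
  have h := single_mem_wordSpan K t (by rintro rfl; exact hn ht.symm)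
  rw [ht] at h
  refine Submodule.span_mono ?_ h
  rintro _ ⟨l, _, _, hl, rfl⟩
  exact ⟨⟨l, hl⟩, rfl⟩

/-- Magmatic monomials of a given arity are linearly independent in the Loday–Ronco algebra. -/
theorem linearIndependent_magEval (n : ℕ) :
    LinearIndependent K fun t : OpTreeOf MagOp n => (dendriform K).magEval (gen K) t.1 := by
  rcases eq_or_ne n 0 with rfl | hn
  · have : IsEmpty (OpTreeOf MagOp 0) := ⟨fun t => t.1.leaves_pos.ne' t.2⟩
    exact linearIndependent_empty_type
  · refine (linearIndependent_word K hn).comp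
      (fun t : OpTreeOf MagOp n => ⟨[t.1], by simpa [forestLeaves] using t.2⟩) ?_
    intro s t h
    exact Subtype.ext (by simpa using h)

end LodayRonco

/-! ### The universal property of the free operad -/

namespace freeBinaryOperad

variable {K : Type u} [CommRing K] {E : Type w} {P : NSOperad.{u, v} K}

/-- The value in an operad `P` of a tree whose vertices are decorated by binary operations. -/
def treeVal (g : E → P.obj 2) : ∀ (t : OpTree E) (n : ℕ), t.leaves = n → P.obj n
  | OpTree.leaf, _, h => (show 1 = _ from h) ▸ P.one
  | OpTree.node e s t, n, h =>
      -- The right input is filled first, so the left one still has position 0 when its turn comes.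
      P.comp 0 t.leaves (m := 1 + t.leaves) (by omega)
        (by simp only [OpTree.leaves] at h; omega)
        (P.comp 1 0 (by omega) (by omega) (g e) (treeVal g t t.leaves rfl))
        (treeVal g s s.leaves rfl)

/-- Grafting into the left subtree is the sequential axiom. Grafting into the right one needs the
parallel axiom to move past the left subtree, then the sequential axiom. -/
theorem treeVal_graft (g : E → P.obj 2) (t : OpTree E) (s : OpTree E) :
    ∀ (a b : ℕ) {m n r : ℕ} (ht : t.leaves = m) (hs : s.leaves = n) (hm : m = a + 1 + b)
      (hr : r = a + n + b) (h : (t.graft a s).leaves = r),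
      treeVal g (t.graft a s) r h = P.comp a b hm hr (treeVal g t m ht) (treeVal g s n hs) := by
  induction t with
  | leaf =>
    intro a b m n r ht hs hm hr h
    simp only [OpTree.leaves] at ht
    subst ht
    obtain rfl : a = 0 := by omega
    obtain rfl : b = 0 := by omega
    obtain rfl : n = r := by omega
    exact (P.one_comp _ _ _).symm
  | node e t₁ t₂ ih₁ ih₂ =>
    intro a b m n r ht hs hm hr h
    have ht' := ht
    simp only [OpTree.leaves] at ht'
    subst hs
    by_cases ha : a < t₁.leaves
    · have hg : (OpTree.node e t₁ t₂).graft a s = OpTree.node e (t₁.graft a s) t₂ := by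
        simp [OpTree.graft, ha]
      have hl := OpTree.leaves_graft t₁ a s ha
      obtain ⟨b', hb'⟩ : ∃ b', t₁.leaves = a + 1 + b' := ⟨t₁.leaves - (a + 1), by omega⟩
      obtain rfl : b = b' + t₂.leaves := by omega
      have hv : treeVal g ((OpTree.node e t₁ t₂).graft a s) r h =
          treeVal g (OpTree.node e (t₁.graft a s) t₂) r (hg ▸ h) := by
        congr 1
      rw [hv, treeVal, treeVal, ih₁ a b' rfl rfl hb' (by omega) rfl]
      have := P.comp_seq 0 t₂.leaves a b' (l := 1 + t₂.leaves) (m := t₁.leaves) (n := s.leaves)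
        (q := m) (r := (t₁.graft a s).leaves) (s := r) (by omega) hb' (by omega) (by omega)
        (by omega) (by omega) (by omega)
        (P.comp 1 0 (by omega) (by omega) (g e) (treeVal g t₂ t₂.leaves rfl))
        (treeVal g t₁ t₁.leaves rfl) (treeVal g s s.leaves rfl)
      simp only [zero_add] at this
      exact this.symm
    · obtain ⟨a', rfl⟩ : ∃ a', a = t₁.leaves + a' := ⟨a - t₁.leaves, by omega⟩
      have hg : (OpTree.node e t₁ t₂).graft (t₁.leaves + a') s =
          OpTree.node e t₁ (t₂.graft a' s) := by
        simp [OpTree.graft]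
      have h₂ : t₂.leaves = a' + 1 + b := by omega
      have hl := OpTree.leaves_graft t₂ a' s (by omega)
      have hv : treeVal g ((OpTree.node e t₁ t₂).graft (t₁.leaves + a') s) r h =
          treeVal g (OpTree.node e t₁ (t₂.graft a' s)) r (hg ▸ h) := by
        congr 1
      rw [hv, treeVal, treeVal, ih₂ a' b rfl rfl h₂ (by omega) rfl]
      have hseq := P.comp_seq 1 0 a' b (l := 2) (m := t₂.leaves) (n := s.leaves)
        (q := 1 + t₂.leaves) (r := (t₂.graft a' s).leaves) (s := 1 + (t₂.graft a' s).leaves)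
        (by omega) h₂ (by omega) (by omega) (by omega) (by omega) (by omega)
        (g e) (treeVal g t₂ t₂.leaves rfl) (treeVal g s s.leaves rfl)
      have hpar := P.comp_par 0 a' b (l := 1 + t₂.leaves) (m := t₁.leaves) (n := s.leaves)
        (q := m) (r := 1 + (t₂.graft a' s).leaves) (s := r)
        (by omega) (by omega) (by omega) (by omega) (by omega) (by omega) (by omega) (by omega)
        (P.comp 1 0 (by omega) (by omega) (g e) (treeVal g t₂ t₂.leaves rfl))
        (treeVal g t₁ t₁.leaves rfl) (treeVal g s s.leaves rfl)
      simp only [zero_add, add_zero] at hseq hpar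
      rw [hseq] at hpar
      have e₁ : (t₂.graft a' s).leaves = a' + s.leaves + b := by omega
      have e₂ : t₂.leaves = a' + 1 + b := h₂
      simp only [← e₁, ← e₂] at hpar
      exact hpar.symm

theorem linearCombination_freeComp (g : E → P.obj 2) (a b : ℕ) {m n r : ℕ} (hm : m = a + 1 + b)
    (hr : r = a + n + b) (f : OpTreeOf E m →₀ K) (f' : OpTreeOf E n →₀ K) :
    Finsupp.linearCombination K (fun t : OpTreeOf E r => treeVal g t.1 r t.2)
        (freeComp K E a b hm hr f f') =
      P.comp a b hm hr
        (Finsupp.linearCombination K (fun t : OpTreeOf E m => treeVal g t.1 m t.2) f)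
        (Finsupp.linearCombination K (fun t : OpTreeOf E n => treeVal g t.1 n t.2) f') := by
  induction f using Finsupp.induction_linear with
  | zero => simp
  | add f₁ f₂ h₁ h₂ => simp only [map_add, LinearMap.add_apply, h₁, h₂]
  | single t x =>
  induction f' using Finsupp.induction_linear with
  | zero => simp
  | add f₁ f₂ h₁ h₂ => simp only [map_add, h₁, h₂]
  | single s y =>
  rw [freeComp_single]
  simp only [Finsupp.linearCombination_single, map_smul, LinearMap.smul_apply, smul_smul]
  rw [OpTreeOf.graft, treeVal_graft g t.1 s.1 a b t.2 s.2 hm hr, mul_comm]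

variable (P) in
/-- The operad morphism out of the free operad determined by the images of the generators. -/
noncomputable def lift (g : E → P.obj 2) : NSOperad.Hom (freeBinaryOperad K E) P where
  app n := Finsupp.linearCombination K fun t : OpTreeOf E n => treeVal g t.1 n t.2
  map_one := (Finsupp.linearCombination_single _ _ _).trans (one_smul _ _)
  map_comp a b _ _ _ hm hr f f' := linearCombination_freeComp g a b hm hr f f'

variable (K) in
/-- A tree, seen as an operation of the free operad. -/
noncomputable def monomial (t : OpTree E) (n : ℕ) (h : t.leaves = n) :
    (freeBinaryOperad K E).obj n :=
  Finsupp.single (⟨t, h⟩ : OpTreeOf E n) (1 : K)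

theorem lift_monomial (g : E → P.obj 2) (t : OpTree E) (n : ℕ) (h : t.leaves = n) :
    (lift P g).app n (monomial K t n h) = treeVal g t n h :=
  (Finsupp.linearCombination_single _ _ _).trans (one_smul _ _)

theorem comp_monomial (t s : OpTree E) (a b : ℕ) {m n r : ℕ} (ht : t.leaves = m)
    (hs : s.leaves = n) (hm : m = a + 1 + b) (hr : r = a + n + b)
    (h : (t.graft a s).leaves = r) :
    (freeBinaryOperad K E).comp a b hm hr (monomial K t m ht) (monomial K s n hs) =
      monomial K (t.graft a s) r h := by
  refine (freeComp_single K E a b hm hr ⟨t, ht⟩ ⟨s, hs⟩ 1 1).trans ?_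
  rw [mul_one]
  rfl

/-- A tree is obtained from its root by composition. -/
theorem monomial_node (e : E) (s t : OpTree E) (n : ℕ) (h : (OpTree.node e s t).leaves = n) :
    monomial K (OpTree.node e s t) n h =
      (freeBinaryOperad K E).comp 0 t.leaves (m := 1 + t.leaves) (by omega)
        (by simp only [OpTree.leaves] at h; omega)
        ((freeBinaryOperad K E).comp 1 0 (by omega) (by omega) (freeGen K e)
          (monomial K t t.leaves rfl))
        (monomial K s s.leaves rfl) := by
  have h₁ := comp_monomial (K := K) (OpTree.node e OpTree.leaf OpTree.leaf) t 1 0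
    (m := 2) (n := t.leaves) (r := 1 + t.leaves) rfl rfl (by omega) (by omega) rfl
  exact ((congrArg (fun f => (freeBinaryOperad K E).comp 0 t.leaves (m := 1 + t.leaves) _ _ f
    (monomial K s s.leaves rfl)) h₁).trans (comp_monomial _ _ _ _ _ _ _ _ _)).symm

theorem hom_monomial (ψ : NSOperad.Hom (freeBinaryOperad K E) P) (t : OpTree E) :
    ∀ (n : ℕ) (h : t.leaves = n), ψ.app n (monomial K t n h) =
      treeVal (fun e => ψ.app 2 (freeGen K e)) t n h := by
  induction t with
  | leaf =>
    intro n h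
    simp only [OpTree.leaves] at h
    subst h
    exact ψ.map_one
  | node e s t ihs iht =>
    intro n h
    rw [monomial_node, ψ.map_comp, ψ.map_comp, ihs, iht]
    rfl

/-- Trees span the free operad and are composites of generators and the identity, so the images of
the generators determine a morphism. -/
theorem hom_eq_lift (ψ : NSOperad.Hom (freeBinaryOperad K E) P) :
    ψ = lift P fun e => ψ.app 2 (freeGen K e) := by
  refine NSOperad.Hom.ext (funext fun n => ?_)
  refine Finsupp.lhom_ext' fun t => LinearMap.ext_ring ?_
  exact (hom_monomial ψ t.1 n t.2).trans (lift_monomial _ t.1 n t.2).symm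

theorem lift_gen (g : E → P.obj 2) (e : E) : (lift P g).app 2 (freeGen K e) = g e :=
  (lift_monomial g (OpTree.node e OpTree.leaf OpTree.leaf) 2 rfl).trans
    ((P.comp_one 0 1 rfl rfl _).trans (P.comp_one 1 0 rfl rfl (g e)))

end freeBinaryOperad

/-! ### Evaluation of operations in an algebra -/

/-- The inputs of a composite at the input `a`: the block of `n` inputs starting at `a` is replaced
by the single input `y`. -/
def plugInput {A : Type v} (a n : ℕ) (y : A) (xs : ℕ → A) (i : ℕ) : A :=
  -- In the last branch i > a, so the truncated subtraction is exact.
  if i < a then xs i else if i = a then y else xs (i + n - 1)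

theorem plugInput_eq_update {A : Type v} (a n : ℕ) (y z : A) (xs : ℕ → A) :
    plugInput a n y xs = Function.update (plugInput a n z xs) a y := by
  funext i
  by_cases h : i = a
  · subst h
    simp [plugInput]
  · simp [plugInput, h]

section Eval

variable {K : Type u} [CommRing K] {A : Type v} [AddCommGroup A] [Module K A] {E : Type w}
  (op : E → A →ₗ[K] A →ₗ[K] A)

namespace OpTree

/-- The value of a monomial in binary operations at given inputs. -/
def eval : OpTree E → (ℕ → A) → A
  | leaf, xs => xs 0
  | node e s t, xs => op e (s.eval xs) (t.eval fun i => xs (i + s.leaves))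

theorem eval_congr (t : OpTree E) {xs ys : ℕ → A} (h : ∀ i < t.leaves, xs i = ys i) :
    t.eval op xs = t.eval op ys := by
  induction t generalizing xs ys with
  | leaf => exact h 0 (by simp [leaves])
  | node e s t ihs iht =>
    simp only [leaves] at h
    rw [eval, eval, ihs fun i hi => h i (by omega), iht fun i hi => h (i + s.leaves) (by omega)]

theorem eval_graft (t s : OpTree E) (a : ℕ) (ha : a < t.leaves) (xs : ℕ → A) :
    (t.graft a s).eval op xs =
      t.eval op (plugInput a s.leaves (s.eval op fun i => xs (i + a)) xs) := by
  induction t generalizing a xs with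
  | leaf =>
    obtain rfl : a = 0 := by simp only [leaves] at ha; omega
    simp [graft, eval, plugInput]
  | node e t₁ t₂ ih₁ ih₂ =>
    simp only [leaves] at ha
    have hs := s.leaves_pos
    by_cases h : a < t₁.leaves
    · have hl := leaves_graft t₁ a s h
      rw [graft, if_pos h, eval, eval, ih₁ a h]
      congr 1
      refine eval_congr op t₂ fun i _ => ?_
      rw [plugInput, if_neg (by omega), if_neg (by omega)]
      congr 1
      omega
    · obtain ⟨a, rfl⟩ : ∃ a', a = t₁.leaves + a' := ⟨a - t₁.leaves, by omega⟩
      rw [graft, if_neg h, eval, eval, Nat.add_sub_cancel_left, ih₂ a (by omega)]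
      rw [eval_congr op t₁ (xs := plugInput _ _ _ xs) (ys := xs) fun i hi => if_pos (by omega)]
      congr 2
      funext i
      have hy : (fun j => xs (j + a + t₁.leaves)) = fun j => xs (j + (t₁.leaves + a)) :=
        funext fun j => congrArg xs (by omega)
      have h₁ : i + t₁.leaves < t₁.leaves + a ↔ i < a := by omega
      have h₂ : i + t₁.leaves = t₁.leaves + a ↔ i = a := by omega
      have h₃ : i + t₁.leaves + s.leaves - 1 = i + s.leaves - 1 + t₁.leaves := by omega
      simp only [plugInput, hy, h₁, h₂, h₃]

/-- Each variable occurs exactly once in a monomial, hence linearity in each input. This permits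
expanding the plugged operation into trees in `freeEval_freeComp`. -/
theorem exists_eval_update_eq (t : OpTree E) (a : ℕ) (ha : a < t.leaves) (xs : ℕ → A) :
    ∃ L : A →ₗ[K] A, ∀ y, t.eval op (Function.update xs a y) = L y := by
  induction t generalizing a xs with
  | leaf =>
    obtain rfl : a = 0 := by simp only [leaves] at ha; omega
    exact ⟨LinearMap.id, fun y => by simp [eval]⟩
  | node e t₁ t₂ ih₁ ih₂ =>
    simp only [leaves] at ha
    by_cases h : a < t₁.leaves
    · obtain ⟨L, hL⟩ := ih₁ a h xs
      refine ⟨((op e).flip (t₂.eval op fun i => xs (i + t₁.leaves))).comp L, fun y => ?_⟩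
      rw [eval, hL, LinearMap.comp_apply, LinearMap.flip_apply]
      congr 2
      funext i
      rw [Function.update_of_ne (by omega)]
    · obtain ⟨L, hL⟩ := ih₂ (a - t₁.leaves) (by omega) fun i => xs (i + t₁.leaves)
      refine ⟨(op e (t₁.eval op xs)).comp L, fun y => ?_⟩
      rw [eval, LinearMap.comp_apply, ← hL,
        eval_congr op t₁ (ys := xs) fun i hi => Function.update_of_ne (by omega) _ _]
      congr 2
      funext i
      by_cases hi : i = a - t₁.leaves
      · subst hi
        rw [Function.update_self, Nat.sub_add_cancel (by omega), Function.update_self]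
      · rw [Function.update_of_ne hi, Function.update_of_ne (by omega)]

end OpTree

/-- Evaluation of an operation of the free operad. -/
noncomputable def freeEval (n : ℕ) : (OpTreeOf E n →₀ K) →ₗ[K] ((ℕ → A) → A) :=
  Finsupp.linearCombination K fun t : OpTreeOf E n => t.1.eval op

theorem freeEval_single {n : ℕ} (t : OpTreeOf E n) (x : K) (xs : ℕ → A) :
    freeEval op n (Finsupp.single t x) xs = x • t.1.eval op xs := by
  simp [freeEval]

theorem freeEval_freeComp (a b : ℕ) {m n r : ℕ} (hm : m = a + 1 + b) (hr : r = a + n + b)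
    (f : OpTreeOf E m →₀ K) (g : OpTreeOf E n →₀ K) (xs : ℕ → A) :
    freeEval op r (freeComp K E a b hm hr f g) xs =
      freeEval op m f (plugInput a n (freeEval op n g fun i => xs (i + a)) xs) := by
  induction f using Finsupp.induction_linear with
  | zero => simp
  | add f₁ f₂ h₁ h₂ => simp only [map_add, LinearMap.add_apply, Pi.add_apply, h₁, h₂]
  | single t x =>
  have ht := t.2
  obtain ⟨L, hL⟩ := t.1.exists_eval_update_eq op a (by omega) (plugInput a n 0 xs)
  rw [plugInput_eq_update a n _ 0, freeEval_single, hL]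
  induction g using Finsupp.induction_linear with
  | zero => simp
  | add f₁ f₂ h₁ h₂ => simp only [map_add, Pi.add_apply, h₁, h₂, smul_add]
  | single s y =>
  rw [freeComp_single, freeEval_single, freeEval_single, map_smul, smul_smul, ← hL,
    ← plugInput_eq_update, OpTreeOf.graft, OpTree.eval_graft op _ _ _ (by omega), s.2]

/-- Operations that vanish on an algebra form an operadic ideal, since composition becomes
substitution. -/
theorem freeEval_eq_zero_of_mem_ideal {R : ∀ n, Set ((freeBinaryOperad K E).obj n)}
    (hR : ∀ n, ∀ f ∈ R n, freeEval op n f = 0) {n : ℕ} {f : (freeBinaryOperad K E).obj n}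
    (hf : (freeBinaryOperad K E).IdealMem R n f) : freeEval op n f = 0 := by
  induction hf with
  | rel f hf => exact hR _ f hf
  | zero n => exact map_zero (freeEval op n)
  | add f g _ _ hf hg => exact (map_add (freeEval op _) f g).trans ((congrArg₂ (· + ·) hf hg).trans (add_zero _))
  | smul k f _ hf => exact (map_smul (freeEval op _) k f).trans ((congrArg (k • ·) hf).trans (smul_zero k))
  | comp_left a b hm hr f g _ hf =>
    funext xs
    exact (freeEval_freeComp op a b hm hr f g xs).trans (by rw [hf]; rfl)
  | comp_right a b hm hr f g _ hg =>
    funext xs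
    refine (freeEval_freeComp op a b hm hr f g xs).trans ?_
    rw [hg]
    -- Composing with the zero operation shows that substituting 0 for an input gives 0.
    have h := freeEval_freeComp op a b hm hr f 0 xs
    rw [map_zero, map_zero, map_zero] at h
    exact h.symm

end Eval

namespace DendriformAlgebra

variable {K : Type u} [CommRing K] {A : Type v} [AddCommGroup A] [Module K A]
  (D : DendriformAlgebra K A)

theorem freeEval_eq_zero_of_dendRel (n : ℕ) (f : (freeBinaryOperad K DendOp).obj n)
    (hf : DendRel K n f) : freeEval D.op n f = 0 := by
  have hl : ∀ e e' xs, freeEval D.op 3 (freeLeft K e e') xs =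
      D.op e' (D.op e (xs 0) (xs 1)) (xs 2) :=
    fun e e' xs => (freeEval_single D.op _ _ xs).trans (one_smul _ _)
  have hr : ∀ e e' xs, freeEval D.op 3 (freeRight K e e') xs =
      D.op e (xs 0) (D.op e' (xs 1) (xs 2)) :=
    fun e e' xs => (freeEval_single D.op _ _ xs).trans (one_smul _ _)
  have hadd : ∀ f g : (freeBinaryOperad K DendOp).obj 3,
      freeEval D.op 3 (f + g) = freeEval D.op 3 f + freeEval D.op 3 g :=
    fun f g => map_add (freeEval D.op 3) f g
  have hsub : ∀ f g : (freeBinaryOperad K DendOp).obj 3,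
      freeEval D.op 3 (f - g) = freeEval D.op 3 f - freeEval D.op 3 g :=
    fun f g => map_sub (freeEval D.op 3) f g
  funext xs
  cases hf with
  | rel₁ =>
    rw [hsub, hadd, Pi.sub_apply, Pi.add_apply, hl, hr, hr, Pi.zero_apply, sub_eq_zero, ← map_add]
    exact D.prec_prec _ _ _
  | rel₂ =>
    rw [hsub, Pi.sub_apply, hl, hr, Pi.zero_apply, sub_eq_zero]
    exact D.succ_prec _ _ _
  | rel₃ =>
    rw [hsub, hadd, Pi.sub_apply, Pi.add_apply, hl, hl, hr, Pi.zero_apply, sub_eq_zero,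
      ← LinearMap.add_apply, ← map_add]
    exact D.succ_succ _ _ _

/-- Evaluation of an operation of `Dend` in a dendriform algebra. -/
noncomputable def eval (n : ℕ) : (Dend K).obj n →ₗ[K] ((ℕ → A) → A) :=
  Submodule.liftQ ((freeBinaryOperad K DendOp).ideal (fun n => {x | DendRel K n x}) n)
    (freeEval D.op n) fun _ hf =>
      freeEval_eq_zero_of_mem_ideal D.op D.freeEval_eq_zero_of_dendRel hf

theorem eval_comp (a b : ℕ) {m n r : ℕ} (hm : m = a + 1 + b) (hr : r = a + n + b)
    (f : (Dend K).obj m) (g : (Dend K).obj n) (xs : ℕ → A) :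
    D.eval r ((Dend K).comp a b hm hr f g) xs =
      D.eval m f (plugInput a n (D.eval n g fun i => xs (i + a)) xs) := by
  obtain ⟨f, rfl⟩ := Submodule.Quotient.mk_surjective _ f
  obtain ⟨g, rfl⟩ := Submodule.Quotient.mk_surjective _ g
  exact freeEval_freeComp D.op a b hm hr f g xs

theorem eval_box (xs : ℕ → A) :
    D.eval 2 (Dend.prec K - Dend.succ K) xs =
      D.prec (xs 0) (xs 1) - D.succ (xs 0) (xs 1) := by
  have h₁ : D.eval 2 (Dend.prec K) xs = D.prec (xs 0) (xs 1) :=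
    (freeEval_single D.op _ _ xs).trans (one_smul _ _)
  have h₂ : D.eval 2 (Dend.succ K) xs = D.succ (xs 0) (xs 1) :=
    (freeEval_single D.op _ _ xs).trans (one_smul _ _)
  rw [map_sub, Pi.sub_apply, h₁, h₂]

theorem eval_treeVal (x : A) (t : OpTree MagOp) : ∀ (n : ℕ) (h : t.leaves = n),
    D.eval n (freeBinaryOperad.treeVal (fun _ => Dend.prec K - Dend.succ K) t n h) (fun _ => x) =
      D.magEval x t := by
  induction t with
  | leaf =>
    intro n h
    simp only [OpTree.leaves] at h
    subst h
    exact (freeEval_single D.op _ _ _).trans (one_smul _ _)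
  | node e s t ihs iht =>
    intro n h
    -- Plugging the left subtree alters only input 0, so the right subtree still sees the constant
    -- input.
    have ht : (fun i => plugInput 0 s.leaves (D.magEval x s) (fun _ => x) (i + 1)) =
        fun _ => x := by
      funext i
      simp [plugInput]
    rw [freeBinaryOperad.treeVal, eval_comp, eval_comp, ihs, ht, iht, eval_box]
    simp [plugInput, magEval]

end DendriformAlgebra

theorem mainTheorem3 (K : Type u) [Field K] [CharZero K] :
    ∃ φ : NSOperad.Hom (Mag K) (Dend K),
      φ.app 2 (Mag.box K) = Dend.prec K - Dend.succ K ∧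
      (∀ ψ : NSOperad.Hom (Mag K) (Dend K),
        ψ.app 2 (Mag.box K) = Dend.prec K - Dend.succ K → ψ = φ) ∧
      φ.Injective := by
  refine ⟨freeBinaryOperad.lift (Dend K) fun _ => Dend.prec K - Dend.succ K,
    freeBinaryOperad.lift_gen _ MagOp.box, fun ψ hψ => ?_, fun n => ?_⟩
  · refine (freeBinaryOperad.hom_eq_lift ψ).trans (congrArg _ (funext fun e => ?_))
    cases e
    exact hψ
  · let D := LodayRonco.dendriform K
    let ev : (Dend K).obj n →ₗ[K] (BinaryTree Unit →₀ K) :=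
      (LinearMap.proj fun _ => LodayRonco.gen K).comp (D.eval n)
    let φ : (OpTreeOf MagOp n →₀ K) →ₗ[K] (Dend K).obj n :=
      (freeBinaryOperad.lift (Dend K) fun _ : MagOp => Dend.prec K - Dend.succ K).app n
    have h : ev.comp φ = Finsupp.linearCombination K
        fun t : OpTreeOf MagOp n => D.magEval (LodayRonco.gen K) t.1 := by
      refine Finsupp.lhom_ext' fun t => LinearMap.ext_ring ?_
      refine Eq.trans ?_ ((Finsupp.linearCombination_single _ _ _).trans (one_smul _ _)).symm
      refine Eq.trans (congrArg ev (freeBinaryOperad.lift_monomial _ t.1 n t.2)) ?_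
      exact D.eval_treeVal (LodayRonco.gen K) t.1 n t.2
    -- Injectivity of this linear combination map is the definition of independence of the
    -- monomials' values.
    have hinj : Function.Injective (ev.comp φ) := by
      rw [h]
      exact LodayRonco.linearIndependent_magEval K n
    exact Function.Injective.of_comp (f := ev) hinj
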